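/- Let $\Bbbk$ be a field, and let $R=\Bbbk[x_1,\dots,x_m]$ and $S=\Bbbk[y_1,\dots,y_n]$ be standard graded polynomial rings with $m,n\ge 1$ and with homogeneous maximal ideals $\mathfrak m=(x_1,\dots,x_m)$ and $\mathfrak n=(y_1,\dots,y_n)$. Let $I\subseteq\mathfrak m^2$ and $J\subseteq\mathfrak n^2$ be homogeneous ideals of $R$ and $S$, respectively. Put $T=R\otimes_{\Bbbk}S$; ideals of $R$ and $S$ are identified with their extensions to $T$. Let $F=I+J+\mathfrak m\mathfrak n\subseteq T$ be the fiber product of $I$ and $J$. For an ideal $L$ of a noetherian ring $A$ and an integer $s\ge 0$, let $$L^{(s)}=\bigcap_{P\in\operatorname{Ass}(A/L)}\bigl(L^sA_P\cap A\bigr)$$ denote the $s$-th symbolic power of $L$ (so $L^{(0)}=A$), where $L^sA_P\cap A$ is the preimage of $L^sA_P$ under $A\to A_P$. Write $\operatorname{depth}(R/I)$ and $\operatorname{depth}(S/J)$ for the depths with respect to $\mathfrak m$ and $\mathfrak n$. If $\min\{\operatorname{depth}(R/I),\operatorname{depth}(S/J)\}\ge 1$, then for all integers $s\ge 1$, $$F^{(s)}=\sum_{i=0}^{s}\sum_{t=0}^{s}\bigl(I^{(i)}\cap\mathfrak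 m^{s-t}\bigr)\bigl(J^{(t)}\cap\mathfrak n^{s-i}\bigr).$$ -/

import Mathlib

open scoped TensorProduct

attribute [local instance] MvPolynomial.gradedAlgebra

namespace FiberProductIdeals

noncomputable section

/-- The `s`-th symbolic power `I^(s) = ⋂_{P ∈ Ass(A/I)} (I^s A_P ∩ A)` of an ideal `I` of a
(noetherian) ring `A`, defined through all associated primes. By this formula
`I^(0)` is the unit ideal. -/
def symbolicPower {A : Type*} [CommRing A] (I : Ideal A) (s : ℕ) : Ideal A :=
  ⨅ P : associatedPrimes A (A ⧸ I),
    ((I ^ s).map (algebraMap A (Localization.AtPrime P.1))).comap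
      (algebraMap A (Localization.AtPrime P.1))

/-- The depth of an `A`-module `M` with respect to an ideal `𝔞`: the supremum of the lengths of
the `M`-regular sequences consisting of elements of `𝔞`. -/
def depth {A : Type*} [CommRing A] (𝔞 : Ideal A) (M : Type*) [AddCommGroup M] [Module A M] :
    ℕ∞ :=
  ⨆ rs : {rs : List A // RingTheory.Sequence.IsRegular M rs ∧ ∀ r ∈ rs, r ∈ 𝔞},
    (rs.1.length : ℕ∞)

/-- The extension to `A ⊗[k] B` of an ideal of `A`. -/
def extLeft (k : Type*) {A : Type*} (B : Type*) [CommRing k] [CommRing A] [CommRing B]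
    [Algebra k A] [Algebra k B] (I : Ideal A) : Ideal (A ⊗[k] B) :=
  I.map (Algebra.TensorProduct.includeLeft : A →ₐ[k] A ⊗[k] B)

/-- The extension to `A ⊗[k] B` of an ideal of `B`. -/
def extRight (k : Type*) (A : Type*) {B : Type*} [CommRing k] [CommRing A] [CommRing B]
    [Algebra k A] [Algebra k B] (J : Ideal B) : Ideal (A ⊗[k] B) :=
  J.map (Algebra.TensorProduct.includeRight : B →ₐ[k] A ⊗[k] B)

/-- The fiber product `I + J + 𝔪𝔫` of ideals `I` and `J` of the polynomial rings `R = k[σ]` and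
`S = k[τ]`, an ideal of `T = R ⊗[k] S`; here `𝔪` and `𝔫` are the ideals generated by the
variables of `R` and `S`. -/
def fiberProduct {k σ τ : Type*} [Field k] (I : Ideal (MvPolynomial σ k))
    (J : Ideal (MvPolynomial τ k)) : Ideal (MvPolynomial σ k ⊗[k] MvPolynomial τ k) :=
  extLeft k (MvPolynomial τ k) I + extRight k (MvPolynomial σ k) J +
    extLeft k (MvPolynomial τ k) (MvPolynomial.idealOfVars σ k) *
      extRight k (MvPolynomial σ k) (MvPolynomial.idealOfVars τ k)

end

end FiberProductIdeals

/-! Let φ and ψ be the projections of T to R and S that kill the other variables. Then F = φ⁻¹(I) ∩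
ψ⁻¹(J), and φ⁻¹(I) = I + 𝔫. Positive depth means that every associated prime P of I misses some x ∈
𝔪, and likewise for J; hence the associated primes of F are exactly the φ⁻¹(P) and the ψ⁻¹(Q).

For ⊆, localizing at the φ⁻¹(P) puts F^(s) inside the symbolic power of I + 𝔫. Reading off
coefficients of monomials in y bounds it by ∑ I^(i) 𝔫^(s-i)
(`mem_tensorSum_of_forall_exists_mul_mem`); by symmetry ∑ 𝔪^(s-t) J^(t) is a bound too. Over a
field, bases adapted to the chains involved show that these two sums intersect termwise
(`tensorSum_inf_tensorSum_le`).

For ⊇, at φ⁻¹(P) the unit x^(s-i) supplies the factor of 𝔪^(s-i) that a generator in I^(i) 𝔫^(s-i)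
needs to enter I^i (𝔪𝔫)^(s-i) ⊆ F^s. -/

namespace FiberProductIdeals

/-! ### Adapted bases and intersections of sums of tensor products -/

section LinearAlgebra

variable {K V W : Type*} [Field K] [AddCommGroup V] [Module K V] [AddCommGroup W] [Module K W]

/-- A linearly independent set adapted to a chain `C` on the subspace `A'` extends to one adapted
to `C` on the larger subspace `A`. -/
lemma exists_adapted_extension {A' A : Submodule K V} (h : A' ≤ A) {C : ℕ → Submodule K V}
    (hC : Monotone C) {b : Set V} (hb : LinearIndepOn K id b) (hbA : b ⊆ A')
    {n : ℕ} (hbC : ∀ j ≤ n, A' ⊓ C j ≤ Submodule.span K (b ∩ C j)) :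
    ∃ b' : Set V, b ⊆ b' ∧ b' ⊆ A ∧ LinearIndepOn K id b' ∧
      ∀ j ≤ n, A ⊓ C j ≤ Submodule.span K (b' ∩ C j) := by
  -- The induction also records that every vector added so far lies in the current `C l`.
  suffices H : ∀ l ≤ n + 1, ∃ b' : Set V, b ⊆ b' ∧ b' ⊆ A ∧ LinearIndepOn K id b' ∧
      (∀ x ∈ b', x ∈ b ∨ x ∈ C l) ∧ ∀ j < l, A ⊓ C j ≤ Submodule.span K (b' ∩ C j) by
    obtain ⟨b', h1, h2, h3, -, h4⟩ := H (n + 1) le_rfl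
    exact ⟨b', h1, h2, h3, fun j hj => h4 j (by lia)⟩
  intro l
  induction l with
  | zero => exact fun _ => ⟨b, subset_rfl, hbA.trans h, hb, fun x hx => .inl hx, by simp⟩
  | succ l ih =>
    intro hl
    obtain ⟨b', h1, h2, h3, h4, h5⟩ := ih (by lia)
    obtain ⟨b'', g1, g2, g3, g4⟩ := exists_linearIndepOn_id_extension h3
      (Set.subset_union_left (t := ((A ⊓ C l : Submodule K V) : Set V)))
    have key : ∀ x ∈ b'', x ∈ b ∨ x ∈ C l := by
      intro x hx
      rcases g1 hx with hx | hx
      · exact h4 x hx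
      · exact .inr hx.2
    refine ⟨b'', h1.trans g2, ?_, g4, fun x hx => (key x hx).imp_right fun h => hC l.le_succ h, ?_⟩
    · intro x hx
      rcases g1 hx with hx | hx
      · exact h2 hx
      · exact hx.1
    · intro j hj
      rcases Nat.lt_succ_iff_lt_or_eq.mp hj with hj | rfl
      · exact (h5 j hj).trans (Submodule.span_mono (Set.inter_subset_inter_left _ g2))
      · intro v hv
        -- Split `v` into old and new vectors. The old part is a difference of elements of `C j`, so
        -- it lies in `A' ⊓ C j`, where `b` is already adapted.
        have hv' : v ∈ Submodule.span K b ⊔ Submodule.span K (b'' ∩ C j) := by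
          rw [← Submodule.span_union]
          refine Submodule.span_mono ?_ (g3 (.inr hv))
          intro x hx
          exact (key x hx).imp id fun h => ⟨hx, h⟩
        obtain ⟨x, hx, y, hy, rfl⟩ := Submodule.mem_sup.mp hv'
        have hyC : y ∈ C j := Submodule.span_le.mpr Set.inter_subset_right hy
        have hxC : x ∈ C j := by simpa using sub_mem hv.2 hyC
        refine add_mem (Submodule.span_mono ?_ (hbC j (by lia)
          ⟨Submodule.span_le.mpr hbA hx, hxC⟩)) hy
        exact Set.inter_subset_inter_left _ (h1.trans g2)

/-- Two finite exhaustive chains of subspaces of a vector space have a common adapted basis. -/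
lemma exists_basis_adapted (A C : ℕ → Submodule K V) (hA : Monotone A) (hC : Monotone C) {n : ℕ}
    (hAn : A n = ⊤) (hCn : C n = ⊤) :
    ∃ (ι : Set V) (b : Module.Basis ι K V),
      (∀ i ≤ n, A i ≤ Submodule.span K (b '' {x | b x ∈ A i})) ∧
      (∀ i ≤ n, C i ≤ Submodule.span K (b '' {x | b x ∈ C i})) := by
  have H : ∀ m, ∃ b : Set V, b ⊆ A m ∧ LinearIndepOn K id b ∧ ∀ i ≤ m, ∀ j ≤ n,
      A i ⊓ C j ≤ Submodule.span K (b ∩ (A i ⊓ C j : Submodule K V)) := by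
    intro m
    induction m with
    | zero =>
      obtain ⟨b, -, h1, h2, h3⟩ := exists_adapted_extension (bot_le : ⊥ ≤ A 0) hC
        (linearIndepOn_empty K id) (Set.empty_subset _) (n := n) (by simp)
      refine ⟨b, h1, h2, fun i hi j hj => ?_⟩
      obtain rfl : i = 0 := by lia
      exact (h3 j hj).trans (Submodule.span_mono fun x hx => ⟨hx.1, h1 hx.1, hx.2⟩)
    | succ m ih =>
      obtain ⟨b, h1, h2, h3⟩ := ih
      obtain ⟨b', g1, g2, g3, g4⟩ := exists_adapted_extension (hA m.le_succ) hC h2 h1 (n := n)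
        fun j hj => (h3 m le_rfl j hj).trans (Submodule.span_mono fun x hx => ⟨hx.1, hx.2.2⟩)
      refine ⟨b', g2, g3, fun i hi j hj => ?_⟩
      rcases hi.lt_or_eq with hi | rfl
      · exact (h3 i (by lia) j hj).trans (Submodule.span_mono (Set.inter_subset_inter_left _ g1))
      · exact (g4 j hj).trans (Submodule.span_mono fun x hx => ⟨hx.1, g2 hx.1, hx.2⟩)
  obtain ⟨b, -, hli, hb⟩ := H n
  have htop : ⊤ ≤ Submodule.span K (Set.range ((↑) : b → V)) := by
    have := hb n le_rfl n le_rfl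
    rw [hAn, hCn, inf_top_eq] at this
    simpa using this
  refine ⟨b, Module.Basis.mk hli htop, fun i hi => ?_, fun i hi => ?_⟩
  · have := hb i hi n le_rfl
    rw [hCn, inf_top_eq] at this
    refine this.trans (Submodule.span_mono ?_)
    rintro x ⟨hx, hx'⟩
    exact ⟨⟨x, hx⟩, by simpa using hx', by simp⟩
  · have := hb n le_rfl i hi
    rw [hAn, top_inf_eq] at this
    refine this.trans (Submodule.span_mono ?_)
    rintro x ⟨hx, hx'⟩
    exact ⟨⟨x, hx⟩, by simpa using hx', by simp⟩

/-- The sum of the subspaces `A i ⊗ B i` of `V ⊗ W` over all `i ≤ n`. -/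
def tensorSum (A : ℕ → Submodule K V) (B : ℕ → Submodule K W) (n : ℕ) : Submodule K (V ⊗[K] W) :=
  Submodule.span K {z | ∃ i ≤ n, ∃ v ∈ A i, ∃ w ∈ B i, v ⊗ₜ[K] w = z}

lemma tmul_mem_span_tmul {ι κ : Type*} (b : ι → V) (c : κ → W) {s : Set ι} {t : Set κ} {v : V}
    {w : W} (hv : v ∈ Submodule.span K (b '' s)) (hw : w ∈ Submodule.span K (c '' t)) :
    v ⊗ₜ[K] w ∈ Submodule.span K ((fun p : ι × κ => b p.1 ⊗ₜ[K] c p.2) '' s ×ˢ t) := by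
  have := Submodule.apply_mem_map₂ (TensorProduct.mk K V W) hv hw
  rw [Submodule.map₂_span_span] at this
  refine Submodule.span_mono ?_ this
  rintro _ ⟨_, ⟨i, hi, rfl⟩, _, ⟨j, hj, rfl⟩, rfl⟩
  exact ⟨(i, j), ⟨hi, hj⟩, rfl⟩

lemma tensorSum_le_span {ι κ : Type*} (b : Module.Basis ι K V) (c : Module.Basis κ K W)
    (A : ℕ → Submodule K V) (B : ℕ → Submodule K W) (n : ℕ)
    (hA : ∀ i ≤ n, A i ≤ Submodule.span K (b '' {x | b x ∈ A i}))
    (hB : ∀ i ≤ n, B i ≤ Submodule.span K (c '' {x | c x ∈ B i})) :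
    tensorSum A B n ≤ Submodule.span K (b.tensorProduct c ''
      {p | ∃ i ≤ n, b p.1 ∈ A i ∧ c p.2 ∈ B i}) := by
  refine Submodule.span_le.mpr ?_
  rintro _ ⟨i, hi, v, hv, w, hw, rfl⟩
  refine Submodule.span_mono ?_ (tmul_mem_span_tmul b c (hA i hi hv) (hB i hi hw))
  rintro _ ⟨p, hp, rfl⟩
  exact ⟨p, ⟨i, hi, hp.1, hp.2⟩, by simp [Module.Basis.tensorProduct_apply']⟩

/-- Sums of tensor products along chains of subspaces intersect termwise. -/
lemma tensorSum_inf_tensorSum_le (A C : ℕ → Submodule K V) (B D : ℕ → Submodule K W) {n : ℕ}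
    (hA : Antitone A) (hC : Monotone C) (hB : Monotone B) (hD : Antitone D)
    (hA0 : A 0 = ⊤) (hCn : C n = ⊤) (hBn : B n = ⊤) (hD0 : D 0 = ⊤) :
    tensorSum A B n ⊓ tensorSum C D n ≤ Submodule.span K {z | ∃ i ≤ n, ∃ t ≤ n,
      ∃ v ∈ A i ⊓ C t, ∃ w ∈ B i ⊓ D t, v ⊗ₜ[K] w = z} := by
  -- The decreasing chains are reindexed by `n - i` to become increasing.
  obtain ⟨ι, b, hb1, hb2⟩ := exists_basis_adapted (fun i => A (n - i)) C
    (fun i j h => hA (by lia)) hC (n := n) (by simpa) hCn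
  obtain ⟨κ, c, hc1, hc2⟩ := exists_basis_adapted B (fun i => D (n - i)) hB
    (fun i j h => hD (by lia)) (n := n) hBn (by simpa)
  have hb1' : ∀ i ≤ n, A i ≤ Submodule.span K (b '' {x | b x ∈ A i}) := fun i hi => by
    simpa [Nat.sub_sub_self hi] using hb1 (n - i) (by lia)
  have hc2' : ∀ i ≤ n, D i ≤ Submodule.span K (c '' {x | c x ∈ D i}) := fun i hi => by
    simpa [Nat.sub_sub_self hi] using hc2 (n - i) (by lia)
  rintro z ⟨h1, h2⟩
  replace h1 := tensorSum_le_span b c A B n hb1' hc1 h1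
  replace h2 := tensorSum_le_span b c C D n hb2 hc2' h2
  -- Both sums are spanned by subsets of one basis of `V ⊗ W`, so intersecting them means
  -- intersecting the two index sets.
  rw [Module.Basis.mem_span_image] at h1 h2
  have h3 := (Module.Basis.mem_span_image (b.tensorProduct c)).mpr (Set.subset_inter h1 h2)
  refine Submodule.span_mono ?_ h3
  rintro _ ⟨⟨p, q⟩, ⟨⟨i, hi, hpA, hqB⟩, ⟨t, ht, hpC, hqD⟩⟩, rfl⟩
  exact ⟨i, hi, t, ht, b p, ⟨hpA, hpC⟩, c q, ⟨hqB, hqD⟩, by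
    simp [Module.Basis.tensorProduct_apply']⟩

end LinearAlgebra

/-! ### Symbolic powers, associated primes and depth -/

section SymbolicPower

variable {A : Type*} [CommRing A]

lemma mem_comap_map_atPrime {P : Ideal A} [P.IsPrime] {I : Ideal A} {x : A} :
    x ∈ (I.map (algebraMap A (Localization.AtPrime P))).comap
      (algebraMap A (Localization.AtPrime P)) ↔ ∃ h ∉ P, h * x ∈ I := by
  rw [Ideal.mem_comap, IsLocalization.algebraMap_mem_map_algebraMap_iff P.primeCompl]
  rfl

lemma mem_symbolicPower {I : Ideal A} {s : ℕ} {x : A} :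
    x ∈ symbolicPower I s ↔ ∀ P ∈ associatedPrimes A (A ⧸ I), ∃ h ∉ P, h * x ∈ I ^ s := by
  rw [symbolicPower, Ideal.mem_iInf]
  constructor
  · intro H P hP
    have := hP.1
    exact mem_comap_map_atPrime.mp (H ⟨P, hP⟩)
  · rintro H ⟨P, hP⟩
    have := hP.1
    exact mem_comap_map_atPrime.mpr (H P hP)

lemma map_mem_pow_of_forall_mem {B : Type*} [CommRing B] (φ : A →+* B) {I : Ideal A} {J : Ideal B}
    (h : ∀ x ∈ I, φ x ∈ J) {s : ℕ} {x : A} (hx : x ∈ I ^ s) : φ x ∈ J ^ s := by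
  refine Ideal.pow_right_mono (Ideal.map_le_iff_le_comap.mpr h) s ?_
  rw [← Ideal.map_pow]
  exact Ideal.mem_map_of_mem φ hx

lemma symbolicPower_zero (I : Ideal A) : symbolicPower I 0 = ⊤ := by
  rw [Ideal.eq_top_iff_one, mem_symbolicPower]
  exact fun P hP => ⟨1, (Ideal.ne_top_iff_one P).mp hP.1.ne_top, by simp⟩

lemma symbolicPower_antitone (I : Ideal A) : Antitone (symbolicPower I) := by
  intro i j hij x hx
  rw [mem_symbolicPower] at hx ⊢
  intro P hP
  obtain ⟨h, h1, h2⟩ := hx P hP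
  exact ⟨h, h1, Ideal.pow_le_pow_right hij h2⟩

lemma mem_associatedPrimes_quotient_iff [IsNoetherianRing A] {I P : Ideal A} :
    P ∈ associatedPrimes A (A ⧸ I) ↔ P.IsPrime ∧ ∃ x, ∀ g, g ∈ P ↔ g * x ∈ I := by
  rw [AssociatedPrimes.mem_iff, isAssociatedPrime_iff]
  refine and_congr_right fun _ => ?_
  rw [Ideal.Quotient.mk_surjective.exists]
  refine exists_congr fun x => ?_
  rw [SetLike.ext_iff]
  refine forall_congr' fun g => iff_congr Iff.rfl ?_
  rw [Submodule.mem_colon_singleton, Submodule.mem_bot, ← Ideal.Quotient.eq_zero_iff_mem, map_mul]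
  rfl

/-- The first term of a regular sequence is a nonzerodivisor on `A ⧸ I`, so it avoids every
associated prime. -/
lemma exists_notMem_of_one_le_depth [IsNoetherianRing A] {𝔞 I : Ideal A}
    (h : 1 ≤ depth 𝔞 (A ⧸ I)) {P : Ideal A}
    (hP : P ∈ associatedPrimes A (A ⧸ I)) : ∃ x ∈ 𝔞, x ∉ P := by
  have h0 : (0 : ℕ∞) < depth 𝔞 (A ⧸ I) := lt_of_lt_of_le zero_lt_one h
  obtain ⟨⟨rs, hrs, hm⟩, hlen⟩ := lt_iSup_iff.mp h0
  match rs, hrs, hm, hlen with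
  | [], _, _, hlen => simp at hlen
  | r :: rs, hrs, hm, _ =>
    refine ⟨r, hm r (by simp), fun hrP => ?_⟩
    obtain ⟨hprime, x, hx⟩ := mem_associatedPrimes_quotient_iff.mp hP
    have hreg := ((RingTheory.Sequence.isWeaklyRegular_cons_iff _ _ _).mp hrs.toIsWeaklyRegular).1
    have h1 : Ideal.Quotient.mk I x = 0 := hreg (by
      refine Eq.trans ?_ (smul_zero r).symm
      exact Ideal.Quotient.eq_zero_iff_mem.mpr ((hx r).mp hrP))
    exact hprime.ne_top ((Ideal.eq_top_iff_one _).mpr ((hx 1).mpr (by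
      simpa using Ideal.Quotient.eq_zero_iff_mem.mp h1)))

end SymbolicPower

/-! ### Coefficients of elements of powers of I + (variables) -/

section Coefficients

open MvPolynomial

variable {A τ : Type*} [CommRing A]

/-- In a product of `s` factors from I + (variables), a monomial of degree d uses the variables of
at most d factors; the others contribute elements of `I`. -/
lemma coeff_mem_of_mem_comap_constantCoeff_pow {I : Ideal A} (s : ℕ) :
    ∀ f ∈ (I.comap (constantCoeff (σ := τ))) ^ s, ∀ α, coeff α f ∈ I ^ (s - α.degree) := by
  classical
  induction s with
  | zero => simp
  | succ s ih =>
    intro f hf α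
    rw [pow_succ'] at hf
    induction hf using Submodule.mul_induction_on' with
    | mem_mul_mem p hp q hq =>
      rw [coeff_mul]
      refine sum_mem fun ab hab => ?_
      have hdeg : ab.1.degree + ab.2.degree = α.degree := by
        rw [← map_add, Finset.HasAntidiagonal.mem_antidiagonal.mp hab]
      have hp' : coeff ab.1 p ∈ I ^ (1 - ab.1.degree) := by
        by_cases h : ab.1 = 0
        · rw [h]
          simpa [constantCoeff_eq] using hp
        · have : ab.1.degree ≠ 0 := by rwa [Ne, Finsupp.degree_eq_zero_iff]
          simp [show 1 - ab.1.degree = 0 by lia]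
      have := Ideal.mul_mem_mul hp' (ih q hq ab.2)
      rw [← pow_add] at this
      exact Ideal.pow_le_pow_right (by lia) this
    | add x _ y _ hx hy => exact coeff_add α x y ▸ add_mem hx hy

/-- Solve the convolution formula for `coeff α f`: the constant term of `g` is a unit at `P`, and
the other terms involve coefficients of `f` of lower degree, which lie locally in higher powers of
`I`. -/
lemma exists_mul_coeff_mem_pow {I P : Ideal A} [P.IsPrime] {s : ℕ} {f g : MvPolynomial τ A}
    (hg : constantCoeff g ∉ P) (hgf : ∀ α, coeff α (g * f) ∈ I ^ (s - α.degree)) (α : τ →₀ ℕ) :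
    ∃ h ∉ P, h * coeff α f ∈ I ^ (s - α.degree) := by
  classical
  induction hn : α.degree using Nat.strong_induction_on generalizing α with
  | _ n ih =>
  subst hn
  have hsum : constantCoeff g * coeff α f ∈
      ((I ^ (s - α.degree)).map (algebraMap A (Localization.AtPrime P))).comap
        (algebraMap A (Localization.AtPrime P)) := by
    have h0 : ((0, α) : (τ →₀ ℕ) × (τ →₀ ℕ)) ∈ Finset.HasAntidiagonal.antidiagonal α := by simp
    have := coeff_mul g f α
    rw [← Finset.add_sum_erase _ _ h0] at this
    rw [constantCoeff_eq, ← sub_eq_of_eq_add this]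
    refine sub_mem (Ideal.le_comap_map (hgf α)) (sum_mem fun ab hab => ?_)
    rw [Finset.mem_erase, Finset.HasAntidiagonal.mem_antidiagonal] at hab
    have hdeg : ab.1.degree + ab.2.degree = α.degree := by rw [← map_add, hab.2]
    have hne : ab.1.degree ≠ 0 := by
      rw [Ne, Finsupp.degree_eq_zero_iff]
      intro h
      apply hab.1
      ext1
      · exact h
      · simpa [h] using hab.2
    refine Ideal.mul_mem_left _ _ (mem_comap_map_atPrime.mpr ?_)
    obtain ⟨h, h1, h2⟩ := ih ab.2.degree (by lia) ab.2 rfl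
    exact ⟨h, h1, Ideal.pow_le_pow_right (by lia) h2⟩
  obtain ⟨h, h1, h2⟩ := mem_comap_map_atPrime.mp hsum
  refine ⟨h * constantCoeff g, ?_, by rwa [mul_assoc]⟩
  exact fun H => (Ideal.IsPrime.mem_or_mem ‹_› H).elim h1 hg

end Coefficients

/-! ### Transfer to the tensor product -/

section Tensor

open MvPolynomial

variable {k A τ : Type*} [Field k] [CommRing A] [Algebra k A]

variable (k A τ) in
/-- The projection `A ⊗ k[τ] → A` evaluating all variables in `τ` at `0`. -/
noncomputable def evalZeroRight : A ⊗[k] MvPolynomial τ k →ₐ[k] A :=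
  Algebra.TensorProduct.lift (AlgHom.id k A) (aeval (0 : τ → A)) fun _ _ => Commute.all _ _

variable (k A τ) in
/-- The projection `k[τ] ⊗ A → A` evaluating all variables in `τ` at `0`. -/
noncomputable def evalZeroLeft : MvPolynomial τ k ⊗[k] A →ₐ[k] A :=
  Algebra.TensorProduct.lift (aeval (0 : τ → A)) (AlgHom.id k A) fun _ _ => Commute.all _ _

@[simp]
lemma evalZeroRight_tmul (a : A) (p : MvPolynomial τ k) :
    evalZeroRight k A τ (a ⊗ₜ p) = a * algebraMap k A (constantCoeff p) := by
  simp [evalZeroRight]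

@[simp]
lemma evalZeroLeft_tmul (a : A) (p : MvPolynomial τ k) :
    evalZeroLeft k A τ (p ⊗ₜ a) = algebraMap k A (constantCoeff p) * a := by
  simp [evalZeroLeft]

lemma constantCoeff_algebraTensorAlgEquiv (f : A ⊗[k] MvPolynomial τ k) :
    constantCoeff (algebraTensorAlgEquiv k A f) = evalZeroRight k A τ f := by
  induction f with
  | zero => simp
  | add x y hx hy => simp [hx, hy]
  | tmul a p => simp [constantCoeff_smul, constantCoeff_map]

lemma mem_tensorSum_of_forall_exists_mul_mem [IsNoetherianRing A] {I : Ideal A} {s : ℕ}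
    {f : A ⊗[k] MvPolynomial τ k}
    (hf : ∀ P ∈ associatedPrimes A (A ⧸ I), ∃ g, evalZeroRight k A τ g ∉ P ∧
      g * f ∈ (I.comap (evalZeroRight k A τ)) ^ s) :
    f ∈ tensorSum (fun i => (symbolicPower I i).restrictScalars k)
      (fun i => (idealOfVars τ k ^ (s - i)).restrictScalars k) s := by
  set e := algebraTensorAlgEquiv (σ := τ) k A with he
  have hcoeff : ∀ α, coeff α (e f) ∈ symbolicPower I (s - α.degree) := by
    intro α
    rw [mem_symbolicPower]
    intro P hP
    have := hP.1
    obtain ⟨g, hg, hgf⟩ := hf P hP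
    have hgf' : e g * e f ∈ (I.comap (constantCoeff (σ := τ))) ^ s := by
      rw [← map_mul]
      refine map_mem_pow_of_forall_mem (RingHomClass.toRingHom e) (fun x hx => ?_) hgf
      change constantCoeff (e x) ∈ I
      rwa [he, constantCoeff_algebraTensorAlgEquiv]
    refine exists_mul_coeff_mem_pow (g := e g) ?_
      (coeff_mem_of_mem_comap_constantCoeff_pow s _ hgf') α
    rwa [he, constantCoeff_algebraTensorAlgEquiv]
  have hsum : f = ∑ α ∈ (e f).support, coeff α (e f) ⊗ₜ[k] monomial α (1 : k) := by
    apply e.injective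
    conv_lhs => rw [(e f).as_sum]
    rw [map_sum]
    refine Finset.sum_congr rfl fun α _ => ?_
    rw [← algebraTensorAlgEquiv_symm_monomial, ← he, AlgEquiv.apply_symm_apply]
  rw [hsum]
  -- If `α.degree > s`, truncation gives index 0, and the monomial still lies in the `s`-th power.
  refine sum_mem fun α _ => Submodule.subset_span
    ⟨s - α.degree, by lia, _, hcoeff α, _, ?_, rfl⟩
  change monomial α (1 : k) ∈ idealOfVars τ k ^ _
  rw [monomial_mem_pow_idealOfVars_iff _ _ one_ne_zero]
  lia

lemma mem_tensorSum_of_forall_exists_mul_mem' [IsNoetherianRing A] {I : Ideal A} {s : ℕ}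
    {f : MvPolynomial τ k ⊗[k] A}
    (hf : ∀ P ∈ associatedPrimes A (A ⧸ I), ∃ g, evalZeroLeft k A τ g ∉ P ∧
      g * f ∈ (I.comap (evalZeroLeft k A τ)) ^ s) :
    f ∈ tensorSum (fun i => (idealOfVars τ k ^ (s - i)).restrictScalars k)
      (fun i => (symbolicPower I i).restrictScalars k) s := by
  set c := Algebra.TensorProduct.comm k (MvPolynomial τ k) A with hc
  have hcomm : ∀ x, evalZeroRight k A τ (c x) = evalZeroLeft k A τ x := by
    intro x
    induction x with
    | zero => simp
    | add x y hx hy => simp [hx, hy]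
    | tmul a p => simp [hc, mul_comm]
  have key : c f ∈ tensorSum (fun i => (symbolicPower I i).restrictScalars k)
      (fun i => (idealOfVars τ k ^ (s - i)).restrictScalars k) s := by
    refine mem_tensorSum_of_forall_exists_mul_mem fun P hP => ?_
    obtain ⟨g, hg, hgf⟩ := hf P hP
    refine ⟨c g, by rwa [hcomm], ?_⟩
    rw [← map_mul]
    refine map_mem_pow_of_forall_mem (RingHomClass.toRingHom c) (fun x hx => ?_) hgf
    change evalZeroRight k A τ (c x) ∈ I
    rwa [hcomm]
  have hle : tensorSum (fun i => (symbolicPower I i).restrictScalars k)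
      (fun i => (idealOfVars τ k ^ (s - i)).restrictScalars k) s ≤
      (tensorSum (fun i => (idealOfVars τ k ^ (s - i)).restrictScalars k)
      (fun i => (symbolicPower I i).restrictScalars k) s).comap c.symm.toLinearMap := by
    refine Submodule.span_le.mpr ?_
    rintro _ ⟨i, hi, v, hv, w, hw, rfl⟩
    refine Submodule.subset_span ⟨i, hi, w, hw, v, hv, ?_⟩
    simp [hc]
  simpa using hle key

end Tensor

/-! ### Associated primes of φ⁻¹(I) ∩ ψ⁻¹(J) -/

section FiberedIdeal

variable {T A B : Type*} [CommRing T] [CommRing A] [CommRing B] {φ : T →+* A} {ψ : T →+* B}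
  {F : Ideal T} {I : Ideal A} {J : Ideal B}

/-- If P = (I : f), then `ι (x * f)` is a witness upstairs: the factor `x` makes the condition on
`J` vacuous and, lying outside `P`, leaves the one on `I` unchanged. -/
lemma comap_mem_associatedPrimes [IsNoetherianRing T] [IsNoetherianRing A]
    (hF : ∀ x, x ∈ F ↔ φ x ∈ I ∧ ψ x ∈ J) {ι : A →+* T} (hι : ∀ a, φ (ι a) = a) {P : Ideal A}
    (hP : P ∈ associatedPrimes A (A ⧸ I)) {x : A} (hx : x ∉ P) (hxψ : ψ (ι x) = 0) :
    P.comap φ ∈ associatedPrimes T (T ⧸ F) := by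
  obtain ⟨hprime, f, hf⟩ := mem_associatedPrimes_quotient_iff.mp hP
  refine mem_associatedPrimes_quotient_iff.mpr ⟨Ideal.comap_isPrime φ P, ι (x * f), fun g => ?_⟩
  rw [hF, map_mul, hι, map_mul, map_mul, map_mul, hxψ, zero_mul, mul_zero,
    and_iff_left J.zero_mem, Ideal.mem_comap, show φ g * (x * f) = x * φ g * f by ring, ← hf]
  exact ⟨fun h => P.mul_mem_left _ h, fun h => (hprime.mem_or_mem h).resolve_left hx⟩

lemma comap_section_mem_associatedPrimes [IsNoetherianRing A] {ι : A →+* T}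
    (hι : ∀ a, φ (ι a) = a) {𝔓 : Ideal T} [𝔓.IsPrime] {f : T} (hf : ∀ g, g ∈ 𝔓 ↔ φ g * φ f ∈ I) :
    𝔓.comap ι ∈ associatedPrimes A (A ⧸ I) ∧ 𝔓 = (𝔓.comap ι).comap φ := by
  constructor
  · refine mem_associatedPrimes_quotient_iff.mpr ⟨Ideal.comap_isPrime ι 𝔓, φ f, fun g => ?_⟩
    rw [Ideal.mem_comap, hf, hι]
  · ext g
    rw [Ideal.mem_comap, Ideal.mem_comap, hf, hf, hι]

lemma exists_eq_comap_of_mem_associatedPrimes [IsNoetherianRing T] [IsNoetherianRing A]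
    [IsNoetherianRing B] (hF : ∀ x, x ∈ F ↔ φ x ∈ I ∧ ψ x ∈ J)
    {ι : A →+* T} (hι : ∀ a, φ (ι a) = a) {κ : B →+* T} (hκ : ∀ b, ψ (κ b) = b) {𝔓 : Ideal T}
    (h𝔓 : 𝔓 ∈ associatedPrimes T (T ⧸ F)) :
    (∃ P ∈ associatedPrimes A (A ⧸ I), 𝔓 = P.comap φ) ∨
      ∃ Q ∈ associatedPrimes B (B ⧸ J), 𝔓 = Q.comap ψ := by
  obtain ⟨hprime, f, hf⟩ := mem_associatedPrimes_quotient_iff.mp h𝔓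
  have hf' : ∀ g, g ∈ 𝔓 ↔ φ g * φ f ∈ I ∧ ψ g * ψ f ∈ J := fun g => by
    rw [hf, hF, map_mul, map_mul]
  -- The prime `𝔓` is the intersection of two pulled-back colon ideals, hence equals one of them.
  have hle : (I.colon {φ f}).comap φ ⊓ (J.colon {ψ f}).comap ψ ≤ 𝔓 := by
    rintro g ⟨h1, h2⟩
    exact (hf' g).mpr ⟨Submodule.mem_colon_singleton.mp h1, Submodule.mem_colon_singleton.mp h2⟩
  rcases hprime.inf_le.mp hle with h | h
  · obtain ⟨h1, h2⟩ := comap_section_mem_associatedPrimes (I := I) hι (f := f) (𝔓 := 𝔓) fun g =>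
      ⟨fun hg => ((hf' g).mp hg).1, fun hg => h (Submodule.mem_colon_singleton.mpr hg)⟩
    exact .inl ⟨_, h1, h2⟩
  · obtain ⟨h1, h2⟩ := comap_section_mem_associatedPrimes (I := J) hκ (f := f) (𝔓 := 𝔓) fun g =>
      ⟨fun hg => ((hf' g).mp hg).2, fun hg => h (Submodule.mem_colon_singleton.mpr hg)⟩
    exact .inr ⟨_, h1, h2⟩

end FiberedIdeal

/-! ### The fiber product and its symbolic powers -/

section FiberProduct

open MvPolynomial

lemma mem_idealOfVars_iff {k σ : Type*} [CommRing k] {p : MvPolynomial σ k} :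
    p ∈ idealOfVars σ k ↔ constantCoeff p = 0 := by
  rw [← pow_one (idealOfVars σ k), mem_pow_idealOfVars_iff']
  refine ⟨fun h => h 0 (by simp), fun h x hx => ?_⟩
  obtain rfl : x = 0 := (Finsupp.degree_eq_zero_iff x).mp (by lia)
  exact h

section Extension

variable {k A B : Type*} [CommRing k] [CommRing A] [CommRing B] [Algebra k A] [Algebra k B]

lemma tmul_one_mem_extLeft {I : Ideal A} {a : A} (ha : a ∈ I) :
    a ⊗ₜ[k] (1 : B) ∈ extLeft k B I :=
  Ideal.mem_map_of_mem (Algebra.TensorProduct.includeLeft : A →ₐ[k] A ⊗[k] B) ha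

lemma one_tmul_mem_extRight {J : Ideal B} {b : B} (hb : b ∈ J) :
    (1 : A) ⊗ₜ[k] b ∈ extRight k A J :=
  Ideal.mem_map_of_mem (Algebra.TensorProduct.includeRight : B →ₐ[k] A ⊗[k] B) hb

lemma tmul_mem_extLeft_mul_extRight {I : Ideal A} {J : Ideal B} {a : A} {b : B} (ha : a ∈ I)
    (hb : b ∈ J) : a ⊗ₜ[k] b ∈ extLeft k B I * extRight k A J := by
  simpa using Ideal.mul_mem_mul (tmul_one_mem_extLeft (k := k) (B := B) ha)
    (one_tmul_mem_extRight (k := k) (A := A) hb)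

lemma extLeft_pow (I : Ideal A) (n : ℕ) : extLeft k B (I ^ n) = extLeft k B I ^ n :=
  Ideal.map_pow _ _ _

lemma extRight_pow (J : Ideal B) (n : ℕ) : extRight k A (J ^ n) = extRight k A J ^ n :=
  Ideal.map_pow _ _ _

end Extension

variable {k σ τ : Type*} [Field k]

/-- On a pure tensor a ⊗ p the expression factors as (a - a(0)) ⊗ (p - p(0)). Thus, modulo 𝔪𝔫, an
element is determined by its two projections. -/
lemma sub_sub_add_mem_extLeft_mul_extRight (x : MvPolynomial σ k ⊗[k] MvPolynomial τ k) :
    x - evalZeroRight k _ τ x ⊗ₜ 1 - 1 ⊗ₜ evalZeroLeft k _ σ x +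
        C (constantCoeff (evalZeroRight k _ τ x)) ⊗ₜ 1 ∈
      extLeft k (MvPolynomial τ k) (idealOfVars σ k) *
        extRight k (MvPolynomial σ k) (idealOfVars τ k) := by
  induction x with
  | zero => simp
  | add x y hx hy =>
    convert add_mem hx hy using 1
    simp only [map_add, TensorProduct.add_tmul, TensorProduct.tmul_add]
    ring
  | tmul a p =>
    have h := tmul_mem_extLeft_mul_extRight (k := k)
      (mem_idealOfVars_iff.mpr (by simp : constantCoeff (a - C (constantCoeff a)) = 0))
      (mem_idealOfVars_iff.mpr (by simp : constantCoeff (p - C (constantCoeff p)) = 0))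
    convert h using 1
    have h1 : (a * C (constantCoeff p)) ⊗ₜ[k] (1 : MvPolynomial τ k) =
        a ⊗ₜ C (constantCoeff p) := by
      rw [mul_comm, ← smul_eq_C_mul, TensorProduct.smul_tmul, smul_eq_C_mul, mul_one]
    have h2 : (1 : MvPolynomial σ k) ⊗ₜ[k] (C (constantCoeff a) * p) =
        C (constantCoeff a) ⊗ₜ p := by
      rw [← smul_eq_C_mul, ← TensorProduct.smul_tmul, smul_eq_C_mul, mul_one]
    have h3 : (C (constantCoeff a) * C (constantCoeff p) : MvPolynomial σ k) ⊗ₜ[k]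
        (1 : MvPolynomial τ k) = C (constantCoeff a) ⊗ₜ C (constantCoeff p) := by
      rw [mul_comm, ← smul_eq_C_mul, TensorProduct.smul_tmul, smul_eq_C_mul, mul_one]
    simp only [evalZeroRight_tmul, evalZeroLeft_tmul, algebraMap_eq, map_mul, constantCoeff_C,
      TensorProduct.sub_tmul, TensorProduct.tmul_sub, h1, h2, h3]
    ring

variable {I : Ideal (MvPolynomial σ k)} {J : Ideal (MvPolynomial τ k)}

lemma mem_fiberProduct_iff (hI : I ≤ idealOfVars σ k) (hJ : J ≤ idealOfVars τ k)
    (x : MvPolynomial σ k ⊗[k] MvPolynomial τ k) :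
    x ∈ fiberProduct I J ↔ evalZeroRight k _ τ x ∈ I ∧ evalZeroLeft k _ σ x ∈ J := by
  constructor
  · revert x
    change fiberProduct I J ≤ I.comap (evalZeroRight k _ τ) ⊓ J.comap (evalZeroLeft k _ σ)
    refine sup_le (sup_le ?_ ?_) (le_inf (Ideal.mul_le_right.trans ?_)
      (Ideal.mul_le_left.trans ?_))
    all_goals
      refine Ideal.map_le_iff_le_comap.mpr fun p hp => ?_
    · simpa [mem_idealOfVars_iff.mp (hI hp)] using hp
    · simpa [mem_idealOfVars_iff.mp (hJ hp)] using hp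
    · simp [mem_idealOfVars_iff.mp hp]
    · simp [mem_idealOfVars_iff.mp hp]
  · rintro ⟨h1, h2⟩
    have h := sub_sub_add_mem_extLeft_mul_extRight x
    rw [mem_idealOfVars_iff.mp (hI h1), map_zero, TensorProduct.zero_tmul, add_zero] at h
    have h3 := Submodule.add_mem_sup (Submodule.add_mem_sup
      (tmul_one_mem_extLeft (k := k) (B := MvPolynomial τ k) h1)
      (one_tmul_mem_extRight (k := k) (A := MvPolynomial σ k) h2)) h
    have hx : x = evalZeroRight k _ τ x ⊗ₜ 1 + 1 ⊗ₜ evalZeroLeft k _ σ x +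
        (x - evalZeroRight k _ τ x ⊗ₜ 1 - 1 ⊗ₜ evalZeroLeft k _ σ x) := by ring
    rw [hx]
    exact h3

lemma extLeft_le_fiberProduct : extLeft k _ I ≤ fiberProduct I J :=
  le_sup_left.trans le_sup_left

lemma extRight_le_fiberProduct : extRight k _ J ≤ fiberProduct I J :=
  le_sup_right.trans le_sup_left

lemma tmul_mem_fiberProduct_pow {n : ℕ} {a : MvPolynomial σ k} {b : MvPolynomial τ k}
    (ha : a ∈ idealOfVars σ k ^ n) (hb : b ∈ idealOfVars τ k ^ n) :
    a ⊗ₜ[k] b ∈ fiberProduct I J ^ n := by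
  have := tmul_mem_extLeft_mul_extRight (k := k) ha hb
  rw [extLeft_pow, extRight_pow, ← mul_pow] at this
  exact Ideal.pow_right_mono le_sup_right n this

lemma tmul_mul_tmul_mem_fiberProduct_pow_left {s i : ℕ} (hi : i ≤ s) {a x : MvPolynomial σ k}
    {b : MvPolynomial τ k} (ha : a ∈ I ^ i) (hx : x ∈ idealOfVars σ k)
    (hb : b ∈ idealOfVars τ k ^ (s - i)) :
    (x ^ (s - i) * a) ⊗ₜ[k] b ∈ fiberProduct I J ^ s := by
  have h1 := tmul_one_mem_extLeft (k := k) (B := MvPolynomial τ k) ha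
  rw [extLeft_pow] at h1
  have := Ideal.mul_mem_mul (tmul_mem_fiberProduct_pow (I := I) (J := J)
    (Ideal.pow_mem_pow hx (s - i)) hb) (Ideal.pow_right_mono (extLeft_le_fiberProduct (J := J)) i h1)
  have hpow := pow_add (fiberProduct I J) (s - i) i
  rw [Nat.sub_add_cancel hi] at hpow
  rw [hpow]
  simpa using this

lemma tmul_mul_tmul_mem_fiberProduct_pow_right {s t : ℕ} (ht : t ≤ s) {b y : MvPolynomial τ k}
    {a : MvPolynomial σ k} (hb : b ∈ J ^ t) (hy : y ∈ idealOfVars τ k)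
    (ha : a ∈ idealOfVars σ k ^ (s - t)) :
    a ⊗ₜ[k] (y ^ (s - t) * b) ∈ fiberProduct I J ^ s := by
  have h1 := one_tmul_mem_extRight (k := k) (A := MvPolynomial σ k) hb
  rw [extRight_pow] at h1
  have := Ideal.mul_mem_mul (tmul_mem_fiberProduct_pow (I := I) (J := J)
    ha (Ideal.pow_mem_pow hy (s - t))) (Ideal.pow_right_mono (extRight_le_fiberProduct (I := I)) t h1)
  have hpow := pow_add (fiberProduct I J) (s - t) t
  rw [Nat.sub_add_cancel ht] at hpow
  rw [hpow]
  simpa using this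

lemma mem_sum_sum_of_mem {A ι κ : Type*} [CommRing A] {s : Finset ι} {t : Finset κ}
    {G : ι → κ → Ideal A} {i : ι} {j : κ} (hi : i ∈ s) (hj : j ∈ t) {x : A} (hx : x ∈ G i j) :
    x ∈ ∑ i ∈ s, ∑ j ∈ t, G i j := by
  rw [Ideal.sum_eq_sup]
  refine Finset.le_sup (f := fun i => ∑ j ∈ t, G i j) hi ?_
  rw [Ideal.sum_eq_sup]
  exact Finset.le_sup (f := G i) hj hx

instance isNoetherianRing_tensorProduct [Finite σ] [Finite τ] :
    IsNoetherianRing (MvPolynomial σ k ⊗[k] MvPolynomial τ k) :=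
  isNoetherianRing_of_ringEquiv _
    (algebraTensorAlgEquiv (σ := τ) k (MvPolynomial σ k)).symm.toRingEquiv

/-- The symbolic powers of a fiber product of ideals with no embedded component at the origin. -/
theorem symbolicPower_fiberProduct [Finite σ] [Finite τ] (hI : I ≤ idealOfVars σ k)
    (hJ : J ≤ idealOfVars τ k) (hdI : 1 ≤ depth (idealOfVars σ k) (MvPolynomial σ k ⧸ I))
    (hdJ : 1 ≤ depth (idealOfVars τ k) (MvPolynomial τ k ⧸ J)) (s : ℕ) :
    symbolicPower (fiberProduct I J) s =
      ∑ i ∈ Finset.range (s + 1), ∑ t ∈ Finset.range (s + 1),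
        extLeft k (MvPolynomial τ k) (symbolicPower I i ⊓ idealOfVars σ k ^ (s - t)) *
          extRight k (MvPolynomial σ k) (symbolicPower J t ⊓ idealOfVars τ k ^ (s - i)) := by
  have hF := mem_fiberProduct_iff hI hJ
  let φ : MvPolynomial σ k ⊗[k] MvPolynomial τ k →+* MvPolynomial σ k :=
    (evalZeroRight k (MvPolynomial σ k) τ).toRingHom
  let ψ : MvPolynomial σ k ⊗[k] MvPolynomial τ k →+* MvPolynomial τ k :=
    (evalZeroLeft k (MvPolynomial τ k) σ).toRingHom
  let ι : MvPolynomial σ k →+* MvPolynomial σ k ⊗[k] MvPolynomial τ k :=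
    Algebra.TensorProduct.includeLeftRingHom
  let κ : MvPolynomial τ k →+* MvPolynomial σ k ⊗[k] MvPolynomial τ k :=
    (Algebra.TensorProduct.includeRight :
      MvPolynomial τ k →ₐ[k] MvPolynomial σ k ⊗[k] MvPolynomial τ k).toRingHom
  have hι : ∀ a, φ (ι a) = a := fun a => by simp [φ, ι]
  have hκ : ∀ b, ψ (κ b) = b := fun b => by simp [ψ, κ]
  apply le_antisymm
  · intro f hf
    rw [mem_symbolicPower] at hf
    have h1 := mem_tensorSum_of_forall_exists_mul_mem (k := k) (I := I) (s := s) (f := f)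
      fun P hP => by
        obtain ⟨x, hx, hxP⟩ := exists_notMem_of_one_le_depth hdI hP
        obtain ⟨g, hg, hgf⟩ := hf _ (comap_mem_associatedPrimes (φ := φ) (ψ := ψ) hF hι hP hxP
          (by simp [ψ, ι, mem_idealOfVars_iff.mp hx]))
        exact ⟨g, hg, Ideal.pow_right_mono (fun x hx => ((hF x).mp hx).1) s hgf⟩
    have h2 := mem_tensorSum_of_forall_exists_mul_mem' (k := k) (I := J) (s := s) (f := f)
      fun P hP => by
        obtain ⟨x, hx, hxP⟩ := exists_notMem_of_one_le_depth hdJ hP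
        obtain ⟨g, hg, hgf⟩ := hf _ (comap_mem_associatedPrimes (φ := ψ) (ψ := φ)
          (fun x => (hF x).trans and_comm) hκ hP hxP (by simp [φ, κ, mem_idealOfVars_iff.mp hx]))
        exact ⟨g, hg, Ideal.pow_right_mono (fun x hx => ((hF x).mp hx).2) s hgf⟩
    have h3 := tensorSum_inf_tensorSum_le _ _ _ _
      (fun i j h => symbolicPower_antitone I h)
      (fun i j h => Ideal.pow_le_pow_right (by lia))
      (fun i j h => Ideal.pow_le_pow_right (by lia))
      (fun i j h => symbolicPower_antitone J h)
      (by simp [symbolicPower_zero]) (by simp) (by simp) (by simp [symbolicPower_zero]) ⟨h1, h2⟩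
    refine (Submodule.span_le (p := Submodule.restrictScalars k _)).mpr ?_ h3
    rintro _ ⟨i, hi, t, ht, v, hv, w, hw, rfl⟩
    exact mem_sum_sum_of_mem (Finset.mem_range.mpr (by lia)) (Finset.mem_range.mpr (by lia))
      (tmul_mem_extLeft_mul_extRight hv ⟨hw.2, hw.1⟩)
  · rw [Ideal.sum_eq_sup]
    refine Finset.sup_le fun i hi => ?_
    rw [Ideal.sum_eq_sup]
    refine Finset.sup_le fun t ht => ?_
    rw [Finset.mem_range] at hi ht
    rw [extLeft, extRight, Ideal.map, Ideal.map, Ideal.span_mul_span', Ideal.span_le]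
    rintro _ ⟨_, ⟨u, hu, rfl⟩, _, ⟨v, hv, rfl⟩, rfl⟩
    obtain ⟨hu1, hu2⟩ := hu
    obtain ⟨hv1, hv2⟩ := hv
    rw [SetLike.mem_coe, mem_symbolicPower] at hu1 hv1 ⊢
    intro 𝔓 h𝔓
    rcases exists_eq_comap_of_mem_associatedPrimes (φ := φ) (ψ := ψ) hF hι hκ h𝔓 with
      ⟨P, hP, rfl⟩ | ⟨Q, hQ, rfl⟩
    · obtain ⟨x, hx, hxP⟩ := exists_notMem_of_one_le_depth hdI hP
      obtain ⟨h, hh, hhu⟩ := hu1 P hP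
      -- Here `h` moves `u` into `I ^ i`, and `x ^ (s - i)` pairs with `v ∈ 𝔫^(s-i)` to land in
      -- (𝔪𝔫)^(s-i).
      refine ⟨ι (x ^ (s - i) * h), ?_, ?_⟩
      · rw [Ideal.mem_comap, hι]
        exact fun H => (hP.1.mem_or_mem H).elim (fun H => hxP (hP.1.mem_of_pow_mem _ H)) hh
      · have := tmul_mul_tmul_mem_fiberProduct_pow_left (I := I) (J := J) (by lia) hhu hx hv2
        simpa [ι, mul_assoc] using this
    · obtain ⟨y, hy, hyQ⟩ := exists_notMem_of_one_le_depth hdJ hQ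
      obtain ⟨h, hh, hhv⟩ := hv1 Q hQ
      refine ⟨κ (y ^ (s - t) * h), ?_, ?_⟩
      · rw [Ideal.mem_comap, hκ]
        exact fun H => (hQ.1.mem_or_mem H).elim (fun H => hyQ (hQ.1.mem_of_pow_mem _ H)) hh
      · have := tmul_mul_tmul_mem_fiberProduct_pow_right (I := I) (J := J) (by lia) hhv hy hu2
        simpa [κ, mul_assoc] using this

end FiberProduct

end FiberProductIdeals

theorem lemma3p2 {k σ τ : Type*} [Field k] [Finite σ] [Nonempty σ] [Finite τ] [Nonempty τ]
    (I : Ideal (MvPolynomial σ k)) (J : Ideal (MvPolynomial τ k))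
    (hI : I.IsHomogeneous (MvPolynomial.homogeneousSubmodule σ k))
    (hJ : J.IsHomogeneous (MvPolynomial.homogeneousSubmodule τ k))
    (hIm : I ≤ MvPolynomial.idealOfVars σ k ^ 2)
    (hJn : J ≤ MvPolynomial.idealOfVars τ k ^ 2)
    (hdepth : 1 ≤ min
      (FiberProductIdeals.depth (MvPolynomial.idealOfVars σ k) (MvPolynomial σ k ⧸ I))
      (FiberProductIdeals.depth (MvPolynomial.idealOfVars τ k) (MvPolynomial τ k ⧸ J)))
    (s : ℕ) (hs : 1 ≤ s) :
    FiberProductIdeals.symbolicPower (FiberProductIdeals.fiberProduct I J) s =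
      ∑ i ∈ Finset.range (s + 1), ∑ t ∈ Finset.range (s + 1),
        FiberProductIdeals.extLeft k (MvPolynomial τ k)
            (FiberProductIdeals.symbolicPower I i ⊓ MvPolynomial.idealOfVars σ k ^ (s - t)) *
          FiberProductIdeals.extRight k (MvPolynomial σ k)
            (FiberProductIdeals.symbolicPower J t ⊓ MvPolynomial.idealOfVars τ k ^ (s - i)) := by
  obtain ⟨hdI, hdJ⟩ := le_min_iff.mp hdepth
  exact FiberProductIdeals.symbolicPower_fiberProduct
    (hIm.trans (Ideal.pow_le_self two_ne_zero)) (hJn.trans (Ideal.pow_le_self two_ne_zero)) hdI hdJ s
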